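/- For finite graphs $H$ and $G$, let $\mathcal{N}(H,G)$ denote the number of (not necessarily induced) subgraphs of $G$ that are isomorphic to $H$, and let $\mathcal{N}(H_1,H_2;G)=\mathcal{N}(H_1,G)+\mathcal{N}(H_2,G)$. Let $\mathrm{ex}(n,(H_1,H_2),F)$ denote the largest value of $\mathcal{N}(H_1,H_2;G)$ over all graphs $G$ on $n$ vertices that contain no (not necessarily induced) subgraph isomorphic to $F$. Let $T_2(n)$ be the complete bipartite graph on $n$ vertices with parts of sizes $\lfloor n/2\rfloor$ and $\lceil n/2\rceil$. Then for every integer $n\ge 0$, $$\mathrm{ex}(n,(K_{2,3},C_5),K_3)=\mathcal{N}(K_{2,3},C_5;T_2(n)).$$ -/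

import Mathlib

namespace SimpleGraph

/-- `𝒩(H₁, H₂; G) = 𝒩(H₁, G) + 𝒩(H₂, G)`, where `𝒩(H, G)` is the number of (not necessarily
induced) subgraphs of `G` that are isomorphic to `H`. -/
noncomputable def pairCopyCount {V W₁ W₂ : Type*} [Fintype V]
    (H₁ : SimpleGraph W₁) (H₂ : SimpleGraph W₂) (G : SimpleGraph V) : ℕ :=
  G.copyCount H₁ + G.copyCount H₂

open scoped Classical in
/-- `ex(n, (H₁, H₂), F)`: the largest value of `𝒩(H₁, H₂; G)` over all `F`-free graphs `G` on `n`
vertices (with value `0` if there is no such graph). -/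
noncomputable def pairExtremalNumber {W₁ W₂ W : Type*} (n : ℕ)
    (H₁ : SimpleGraph W₁) (H₂ : SimpleGraph W₂) (F : SimpleGraph W) : ℕ :=
  Finset.sup {G : SimpleGraph (Fin n) | F.Free G} (fun G => pairCopyCount H₁ H₂ G)

end SimpleGraph

/-! Count labelled copies through an ordered edge `uv`. With `a`, `b` other neighbours of `u`, `v`
and `c` far vertices, triangle-freeness gives `a + b + c + 2 = n`. Of the `a * b` cross pairs, `m`
are adjacent and `k` are not: adjacent ones extend to `K_{2,3}`, nonadjacent ones close up to `C_5`
through a far vertex. Averaged over orientations, each edge's weighted contribution is at most its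
value in `T_2(n)` (for `n ≥ 6`), and Mantel's theorem bounds the number of edges. Dividing by the
automorphism counts 12 and 10 returns to unlabelled copies. -/

open Finset

namespace SimpleGraph

/-! ### Labelled versus unlabelled copies. -/

section Counting

variable {V W : Type*}

/-- Copies of `H` in `G` with a prescribed image `G'` correspond to isomorphisms `H ≃g G'.coe`. -/
noncomputable def Copy.fiberEquiv {H : SimpleGraph W} {G : SimpleGraph V} (G' : G.Subgraph) :
    {f : Copy H G // f.toSubgraph = G'} ≃ (H ≃g G'.coe) where
  toFun f := f.2 ▸ f.1.isoToSubgraph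
  invFun e := ⟨⟨G'.hom.comp e.toHom, Subgraph.hom_injective.comp e.injective⟩, by
    simp [Copy.toSubgraph, Subgraph.map_comp]⟩
  left_inv := by
    rintro ⟨f, rfl⟩
    rfl
  right_inv e := by
    have key : ∀ (f : Copy H G) (h : f.toSubgraph = G') (x : W),
        (((h ▸ f.isoToSubgraph : H ≃g G'.coe) x : G'.verts) : V) = f x := by
      rintro f rfl x
      rfl
    apply RelIso.ext
    intro x
    apply Subtype.ext
    rw [key]
    rfl

/-- The number of labelled copies is the number of copies times the number of automorphisms. -/
theorem labelledCopyCount_eq_copyCount_mul [Fintype V] [Fintype W] (G : SimpleGraph V)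
    (H : SimpleGraph W) : G.labelledCopyCount H = G.copyCount H * Nat.card (H ≃g H) := by
  classical
  unfold labelledCopyCount copyCount
  rw [← Finset.card_univ, Finset.card_eq_sum_card_fiberwise (f := Copy.toSubgraph)
    (t := {G' : G.Subgraph | Nonempty (H ≃g G'.coe)})]
  · rw [Finset.sum_const_nat]
    intro G' hG'
    obtain ⟨e⟩ := (Finset.mem_filter.1 hG').2
    rw [← Fintype.card_subtype, ← Nat.card_eq_fintype_card,
      Nat.card_congr (Copy.fiberEquiv G')]
    exact Nat.card_congr
      ⟨fun f => f.trans e.symm, fun f => f.trans e, fun f => by ext; simp, fun f => by ext; simp⟩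
  · intro f _
    simpa using ⟨f.isoToSubgraph⟩

theorem labelledCopyCount_eq_natCard [Fintype V] [Fintype W] (G : SimpleGraph V)
    (H : SimpleGraph W) : G.labelledCopyCount H = Nat.card (Copy H G) := by
  classical
  rw [labelledCopyCount, ← Nat.card_eq_fintype_card]

theorem labelledCopyCount_le_card_of_injective [Fintype V] [Fintype W] {G : SimpleGraph V}
    {H : SimpleGraph W} {α : Type*} (s : Finset α) (F : Copy H G → α) (hF : ∀ f, F f ∈ s)
    (hinj : Function.Injective F) : G.labelledCopyCount H ≤ #s := by
  rw [labelledCopyCount_eq_natCard, ← Fintype.card_coe, ← Nat.card_eq_fintype_card]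
  exact Nat.card_le_card_of_injective (fun f => (⟨F f, hF f⟩ : s)) fun f g h =>
    hinj (congrArg Subtype.val h)

theorem card_iso_self_eq [Fintype W] [DecidableEq W] (H : SimpleGraph W) [DecidableRel H.Adj] :
    Nat.card (H ≃g H) =
      #{s : Equiv.Perm W | ∀ a b, H.Adj (s a) (s b) ↔ H.Adj a b} := by
  rw [← Fintype.card_subtype, ← Nat.card_eq_fintype_card]
  exact Nat.card_congr ⟨fun e => ⟨e.toEquiv, fun a b => e.map_rel_iff⟩,
    fun s => ⟨s.1, fun {a b} => s.2 a b⟩, fun _ => rfl, fun _ => rfl⟩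

theorem card_iso_cycleGraph_five : Nat.card (cycleGraph 5 ≃g cycleGraph 5) = 10 := by
  rw [card_iso_self_eq]
  decide +kernel

instance decidableRelCompleteBipartiteGraphAdj (V W : Type*) :
    DecidableRel (completeBipartiteGraph V W).Adj := fun a b =>
  inferInstanceAs (Decidable (a.isLeft ∧ b.isRight ∨ a.isRight ∧ b.isLeft))

theorem card_iso_completeBipartiteGraph_two_three :
    Nat.card (completeBipartiteGraph (Fin 2) (Fin 3) ≃g
      completeBipartiteGraph (Fin 2) (Fin 3)) = 12 := by
  rw [card_iso_self_eq]
  decide +kernel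

end Counting

/-! ### Counting copies edge by edge. -/

section Local

variable {V : Type*} [Fintype V] [DecidableEq V] (G : SimpleGraph V) [DecidableRel G.Adj]

/-- The ordered pairs of adjacent vertices. -/
def adjPairs : Finset (V × V) := {p | G.Adj p.1 p.2}

/-- The neighbors of `u` other than `v`. -/
def otherNeighbors (u v : V) : Finset V := (G.neighborFinset u).erase v

/-- The adjacent pairs between the other neighbors of `v` and those of `u`. -/
def crossPairs (u v : V) : Finset (V × V) :=
  {p ∈ G.otherNeighbors v u ×ˢ G.otherNeighbors u v | G.Adj p.1 p.2}

/-- The nonadjacent pairs between the other neighbors of `v` and those of `u`. -/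
def crossNonPairs (u v : V) : Finset (V × V) :=
  {p ∈ G.otherNeighbors v u ×ˢ G.otherNeighbors u v | ¬ G.Adj p.1 p.2}

/-- The vertices adjacent to neither `u` nor `v`. -/
def farVertices (u v : V) : Finset V := (G.neighborFinset u ∪ G.neighborFinset v)ᶜ

variable {G}

theorem card_crossPairs_comm (u v : V) : #(G.crossPairs u v) = #(G.crossPairs v u) := by
  refine Finset.card_bij' (fun p _ => p.swap) (fun p _ => p.swap) ?_ ?_ ?_ ?_ <;>
    simp +contextual [crossPairs, G.adj_comm]

theorem card_crossPairs_add_card_crossNonPairs (u v : V) :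
    #(G.crossPairs u v) + #(G.crossNonPairs u v) =
      #(G.otherNeighbors u v) * #(G.otherNeighbors v u) := by
  rw [crossPairs, crossNonPairs, Finset.card_filter_add_card_filter_not, Finset.card_product,
    mul_comm]

omit [Fintype V] [DecidableRel G.Adj] in
theorem CliqueFree.not_adj_of_adj_of_adj (h : G.CliqueFree 3) {x y z : V} (hxy : G.Adj x y)
    (hyz : G.Adj y z) : ¬ G.Adj x z := fun hxz =>
  h {x, y, z} (is3Clique_triple_iff.2 ⟨hxy, hxz, hyz⟩)

theorem CliqueFree.card_otherNeighbors_add (h : G.CliqueFree 3) {u v : V} (huv : G.Adj u v) :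
    #(G.otherNeighbors u v) + #(G.otherNeighbors v u) + #(G.farVertices u v) + 2 =
      Fintype.card V := by
  have hd : Disjoint (G.neighborFinset u) (G.neighborFinset v) := by
    rw [Finset.disjoint_left]
    intro w hu hv
    rw [mem_neighborFinset] at hu hv
    exact h.not_adj_of_adj_of_adj huv hv hu
  have h1 := Finset.card_erase_add_one ((G.mem_neighborFinset u v).2 huv)
  have h2 := Finset.card_erase_add_one ((G.mem_neighborFinset v u).2 huv.symm)
  have h3 := Finset.card_add_card_compl (G.neighborFinset u ∪ G.neighborFinset v)
  rw [Finset.card_union_of_disjoint hd] at h3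
  unfold otherNeighbors farVertices
  omega

/-- Only an upper bound: the last vertex is required to be adjacent to `u`, not to the other vertex
of the 2-side. -/
theorem labelledCopyCount_completeBipartiteGraph_le :
    G.labelledCopyCount (completeBipartiteGraph (Fin 2) (Fin 3)) ≤
      ∑ p ∈ G.adjPairs, #(G.crossPairs p.1 p.2) * (#(G.otherNeighbors p.1 p.2) - 1) := by
  classical
  have hcard : ∀ p ∈ G.adjPairs, #((G.crossPairs p.1 p.2).sigma fun q =>
      (G.otherNeighbors p.1 p.2).erase q.2) =
        #(G.crossPairs p.1 p.2) * (#(G.otherNeighbors p.1 p.2) - 1) := by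
    intro p _
    rw [Finset.card_sigma, Finset.sum_const_nat]
    intro q hq
    exact Finset.card_erase_of_mem (Finset.mem_product.1 (Finset.mem_filter.1 hq).1).2
  rw [← Finset.sum_congr rfl hcard, ← Finset.card_sigma]
  refine labelledCopyCount_le_card_of_injective _ (fun f : Copy _ G =>
    (⟨(f (.inl 0), f (.inr 0)), ⟨(f (.inl 1), f (.inr 1)), f (.inr 2)⟩⟩ :
      (_ : V × V) × (_ : V × V) × V)) ?_ ?_
  · intro f
    have hf : ∀ i j, G.Adj (f (Sum.inl i)) (f (Sum.inr j)) := fun i j => f.toHom.map_adj (by simp)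
    have hn : ∀ i j, i ≠ j → f i ≠ f j := fun i j => f.injective.ne
    simp [adjPairs, crossPairs, otherNeighbors, hf, fun i j => (hf i j).symm, hn]
  · intro f g h
    simp only [Sigma.mk.injEq, Prod.mk.injEq, heq_eq_eq] at h
    obtain ⟨⟨h1, h2⟩, ⟨h3, h4⟩, h5⟩ := h
    apply Copy.ext
    rw [Sum.forall, Fin.forall_fin_two, Fin.forall_fin_succ, Fin.forall_fin_two]
    exact ⟨⟨h1, h3⟩, h2, h4, h5⟩

/-- In a triangle-free graph every 5-cycle is induced: `f 2` and `f 4` share the neighbour `f 3`,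
and `f 3` is far from the edge `f 0`, `f 1`. -/
theorem CliqueFree.labelledCopyCount_cycleGraph_five_le (h : G.CliqueFree 3) :
    G.labelledCopyCount (cycleGraph 5) ≤
      ∑ p ∈ G.adjPairs, #(G.crossNonPairs p.1 p.2) * #(G.farVertices p.1 p.2) := by
  classical
  simp_rw [← Finset.card_product]
  rw [← Finset.card_sigma]
  refine labelledCopyCount_le_card_of_injective _ (fun f : Copy _ G =>
    (⟨(f 0, f 1), ((f 2, f 4), f 3)⟩ : (_ : V × V) × (V × V) × V)) ?_ ?_
  · intro f
    have h01 : G.Adj (f 0) (f 1) := f.toHom.map_adj (cycleGraph_adj.2 (by decide))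
    have h12 : G.Adj (f 1) (f 2) := f.toHom.map_adj (cycleGraph_adj.2 (by decide))
    have h23 : G.Adj (f 2) (f 3) := f.toHom.map_adj (cycleGraph_adj.2 (by decide))
    have h34 : G.Adj (f 3) (f 4) := f.toHom.map_adj (cycleGraph_adj.2 (by decide))
    have h40 : G.Adj (f 4) (f 0) := f.toHom.map_adj (cycleGraph_adj.2 (by decide))
    have hn : ∀ i j, i ≠ j → f i ≠ f j := fun i j => f.injective.ne
    simp [adjPairs, crossNonPairs, otherNeighbors, farVertices, h01, h12, h40.symm, hn,
      h.not_adj_of_adj_of_adj h23 h34, h.not_adj_of_adj_of_adj h12 h23,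
      h.not_adj_of_adj_of_adj h40.symm h34.symm]
  · intro f g h
    simp only [Sigma.mk.injEq, Prod.mk.injEq, heq_eq_eq] at h
    obtain ⟨⟨h1, h2⟩, ⟨h3, h4⟩, h5⟩ := h
    apply Copy.ext
    rw [Fin.forall_fin_succ, Fin.forall_fin_succ, Fin.forall_fin_succ, Fin.forall_fin_two]
    exact ⟨h1, h2, h3, h5, h4⟩

omit [DecidableEq V] in
theorem sum_adjPairs_swap (F : V → V → ℕ) :
    ∑ p ∈ G.adjPairs, F p.1 p.2 = ∑ p ∈ G.adjPairs, F p.2 p.1 := by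
  refine Finset.sum_bij' (fun p _ => p.swap) (fun p _ => p.swap) ?_ ?_ ?_ ?_ ?_ <;>
    simp [adjPairs, G.adj_comm]

omit [DecidableEq V] in
theorem CliqueFree.card_adjPairs_le (h : G.CliqueFree 3) :
    #G.adjPairs ≤ 2 * ((Fintype.card V / 2) * (Fintype.card V - Fintype.card V / 2)) := by
  have h1 : 2 * #G.edgeFinset = #G.adjPairs := G.two_mul_card_edgeFinset
  have h2 := CliqueFree.card_edgeFinset_le (r := 2) h
  rw [← h1]
  refine Nat.mul_le_mul_left 2 (h2.trans ?_)
  obtain ⟨k, hk | hk⟩ := Nat.even_or_odd' (Fintype.card V)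
  · rw [hk]
    have : 2 * k / 2 = k := by omega
    have h3 : 2 * k - k = k := by omega
    simp only [Nat.mul_mod_right, this, h3]
    apply le_of_eq
    rw [Nat.choose_eq_zero_of_lt (by norm_num), add_zero]
    apply Nat.div_eq_of_eq_mul_left (by norm_num)
    simp
    ring
  · rw [hk]
    have : (2 * k + 1) / 2 = k := by omega
    have h3 : 2 * k + 1 - k = k + 1 := by omega
    have h4 : (2 * k + 1) % 2 = 1 := by omega
    simp only [this, h3, h4]
    apply le_of_eq
    rw [Nat.choose_eq_zero_of_lt (by norm_num), add_zero]
    apply Nat.div_eq_of_eq_mul_left (by norm_num)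
    have h5 : (2 * k + 1) ^ 2 = k * (k + 1) * 4 + 1 := by ring
    omega

/-- Bounding a weighted sum of the two labelled copy counts by a bound valid at every edge. -/
theorem CliqueFree.weighted_labelledCopyCount_le (h : G.CliqueFree 3) (s t M : ℕ)
    (hM : ∀ a b c m k : ℕ, a + b + c + 2 = Fintype.card V → m + k = a * b →
      s * (m * (a - 1) + m * (b - 1)) + 2 * t * (k * c) ≤ M) :
    2 * (s * G.labelledCopyCount (completeBipartiteGraph (Fin 2) (Fin 3)) +
      t * G.labelledCopyCount (cycleGraph 5)) ≤
      2 * ((Fintype.card V / 2) * (Fintype.card V - Fintype.card V / 2)) * M := by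
  have h1 := labelledCopyCount_completeBipartiteGraph_le (G := G)
  have h2 := h.labelledCopyCount_cycleGraph_five_le
  have h3 := sum_adjPairs_swap (G := G) fun u v =>
    #(G.crossPairs u v) * (#(G.otherNeighbors u v) - 1)
  have h4 : ∑ p ∈ G.adjPairs, (s * (#(G.crossPairs p.1 p.2) * (#(G.otherNeighbors p.1 p.2) - 1) +
      #(G.crossPairs p.2 p.1) * (#(G.otherNeighbors p.2 p.1) - 1)) +
      2 * t * (#(G.crossNonPairs p.1 p.2) * #(G.farVertices p.1 p.2))) ≤ #G.adjPairs * M := by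
    rw [← smul_eq_mul (#G.adjPairs) M]
    refine Finset.sum_le_card_nsmul _ _ _ fun p hp => ?_
    rw [card_crossPairs_comm p.2 p.1]
    exact hM _ _ _ _ _ (h.card_otherNeighbors_add (Finset.mem_filter.1 hp).2)
      (card_crossPairs_add_card_crossNonPairs _ _)
  rw [Finset.sum_add_distrib, ← Finset.mul_sum, ← Finset.mul_sum, Finset.sum_add_distrib, ← h3]
    at h4
  refine le_trans ?_ (h4.trans (Nat.mul_le_mul_right M h.card_adjPairs_le))
  have h5 := Nat.mul_le_mul_left s h1
  have h6 := Nat.mul_le_mul_left t h2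
  linarith

end Local

/-! ### Lower bound for the Turán graph. -/

section Turan

theorem le_labelledCopyCount_of_forall_adj {V : Type*} [Fintype V] {G : SimpleGraph V}
    {X Y : Finset V} (hXY : ∀ x : X, ∀ y : Y, G.Adj x y) :
    (#X).descFactorial 2 * (#Y).descFactorial 3 + (#Y).descFactorial 2 * (#X).descFactorial 3 ≤
      G.labelledCopyCount (completeBipartiteGraph (Fin 2) (Fin 3)) := by
  classical
  have hc : Fintype.card ((Fin 2 ↪ X) × (Fin 3 ↪ Y) ⊕ (Fin 2 ↪ Y) × (Fin 3 ↪ X)) =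
      (#X).descFactorial 2 * (#Y).descFactorial 3 +
        (#Y).descFactorial 2 * (#X).descFactorial 3 := by
    simp only [Fintype.card_sum, Fintype.card_prod, Fintype.card_embedding_eq, Fintype.card_coe,
      Fintype.card_fin]
  have hinj : ∀ {m k : ℕ} {A B : Finset V} (p : Fin m ↪ A) (q : Fin k ↪ B),
      (∀ x : A, ∀ y : B, G.Adj x y) →
      Function.Injective (Sum.elim (fun i => (p i : V)) fun j => (q j : V)) := by
    intro m k A B p q hAB
    exact (Subtype.val_injective.comp p.injective).sumElim
      (Subtype.val_injective.comp q.injective) fun i j => (hAB _ _).ne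
  have hhom : ∀ {m k : ℕ} {A B : Finset V} (p : Fin m ↪ A) (q : Fin k ↪ B),
      (∀ x : A, ∀ y : B, G.Adj x y) → ∀ {a b}, (completeBipartiteGraph (Fin m) (Fin k)).Adj a b →
      G.Adj (Sum.elim (fun i => (p i : V)) (fun j => (q j : V)) a)
        (Sum.elim (fun i => (p i : V)) (fun j => (q j : V)) b) := by
    rintro m k A B p q hAB (i | i) (j | j) hij
    · simp at hij
    · exact hAB _ _
    · exact (hAB _ _).symm
    · simp at hij
  have hYX : ∀ y : Y, ∀ x : X, G.Adj y x := fun y x => (hXY x y).symm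
  let toCopy : (Fin 2 ↪ X) × (Fin 3 ↪ Y) ⊕ (Fin 2 ↪ Y) × (Fin 3 ↪ X) →
      Copy (completeBipartiteGraph (Fin 2) (Fin 3)) G := Sum.elim
    (fun p => ⟨⟨_, hhom p.1 p.2 hXY⟩, hinj p.1 p.2 hXY⟩)
    (fun p => ⟨⟨_, hhom p.1 p.2 hYX⟩, hinj p.1 p.2 hYX⟩)
  have hinj' : Function.Injective toCopy := by
    rintro (⟨p, q⟩ | ⟨p, q⟩) (⟨p', q'⟩ | ⟨p', q'⟩) hpq
    · have hi : ∀ i, p i = p' i := fun i => Subtype.ext (DFunLike.congr_fun hpq (Sum.inl i))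
      have hj : ∀ j, q j = q' j := fun j => Subtype.ext (DFunLike.congr_fun hpq (Sum.inr j))
      rw [DFunLike.ext _ _ hi, DFunLike.ext _ _ hj]
    -- A vertex in both `X` and `Y` would be adjacent to itself.
    · have h0 : (p 0 : V) = (p' 0 : V) := DFunLike.congr_fun hpq (Sum.inl 0)
      exact absurd h0 (hXY _ _).ne
    · have h0 : (p 0 : V) = (p' 0 : V) := DFunLike.congr_fun hpq (Sum.inl 0)
      exact absurd h0 (hYX _ _).ne
    · have hi : ∀ i, p i = p' i := fun i => Subtype.ext (DFunLike.congr_fun hpq (Sum.inl i))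
      have hj : ∀ j, q j = q' j := fun j => Subtype.ext (DFunLike.congr_fun hpq (Sum.inr j))
      rw [DFunLike.ext _ _ hi, DFunLike.ext _ _ hj]
  have : Finite (Copy (completeBipartiteGraph (Fin 2) (Fin 3)) G) :=
    Finite.of_injective _ DFunLike.coe_injective
  rw [← hc, labelledCopyCount_eq_natCard, ← Nat.card_eq_fintype_card]
  exact Nat.card_le_card_of_injective toCopy hinj'

theorem le_labelledCopyCount_turanGraph_two (n : ℕ) :
    (n - n / 2).descFactorial 2 * (n / 2).descFactorial 3 +
      (n / 2).descFactorial 2 * (n - n / 2).descFactorial 3 ≤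
      (turanGraph n 2).labelledCopyCount (completeBipartiteGraph (Fin 2) (Fin 3)) := by
  let X : Finset (Fin n) := {x | (x : ℕ) % 2 = 0}
  let Y : Finset (Fin n) := {x | ¬ (x : ℕ) % 2 = 0}
  have hX : #X = n - n / 2 := by
    rw [← Finset.card_range (n - n / 2)]
    refine Finset.card_bij' (fun x _ => (x : ℕ) / 2)
      (fun k hk => ⟨2 * k, by have := Finset.mem_range.1 hk; omega⟩) ?_ ?_ ?_ ?_
    · intro x _
      have := x.2
      rw [Finset.mem_range]
      omega
    · intro k _
      simp [X]
    · intro x hx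
      have := (Finset.mem_filter.1 hx).2
      ext
      dsimp only
      omega
    · intro k _
      dsimp only
      omega
  have hY : #Y = n / 2 := by
    have h := Finset.card_filter_add_card_filter_not (s := (Finset.univ : Finset (Fin n)))
      fun x => (x : ℕ) % 2 = 0
    rw [Finset.card_univ, Fintype.card_fin] at h
    change #X + #Y = n at h
    omega
  rw [← hX, ← hY]
  refine le_labelledCopyCount_of_forall_adj fun x y => ?_
  have hx := (Finset.mem_filter.1 x.2).2
  have hy := (Finset.mem_filter.1 y.2).2
  rw [turanGraph_adj]
  omega

end Turan

/-! ### Numerical bounds at one edge. -/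

section Bounds

theorem edge_bound_of_large {p q a b c m k : ℕ} (hp : 3 ≤ p) (hpq : p ≤ q) (hqp : q ≤ p + 1)
    (hs : a + b + c + 2 = p + q) (hm : m + k = a * b) :
    5 * (m * (a - 1) + m * (b - 1)) + 2 * 6 * (k * c) ≤
      5 * ((p - 1) * (q - 1) * (p + q - 4)) := by
  rcases Nat.eq_zero_or_pos a with rfl | ha
  · obtain ⟨rfl, rfl⟩ : m = 0 ∧ k = 0 := by simpa using hm
    simp
  rcases Nat.eq_zero_or_pos b with rfl | hb
  · obtain ⟨rfl, rfl⟩ : m = 0 ∧ k = 0 := by simpa using hm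
    simp
  obtain ⟨P, rfl⟩ : ∃ P, p = P + 1 := ⟨p - 1, by omega⟩
  obtain ⟨Q, rfl⟩ : ∃ Q, q = Q + 1 := ⟨q - 1, by omega⟩
  have hab : a * b ≤ P * Q := by
    rcases (show Q = P ∨ Q = P + 1 by omega) with rfl | rfl
    · have : a + b ≤ 2 * Q := by omega
      nlinarith [sq_nonneg ((a : ℤ) - b)]
    · have h1 : a + b ≤ 2 * P + 1 := by omega
      rcases le_or_gt a P with h2 | h2
      · nlinarith
      · nlinarith
  have h1 : 12 * (a * b * c) ≤ 5 * (P * Q * (P + 1 + (Q + 1) - 4)) := by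
    rcases Nat.eq_zero_or_pos c with rfl | hc
    · simp
    zify [show 4 ≤ P + 1 + (Q + 1) by omega]
    have hN : (c : ℤ) = P + Q - (a + b) := by omega
    have hP : (2 : ℤ) ≤ P := by omega
    have h1 : 4 * ((a : ℤ) * b) ≤ (a + b) ^ 2 := by nlinarith [sq_nonneg ((a : ℤ) - b)]
    have h2 : 27 * ((a + b : ℤ) ^ 2 * c) ≤ 4 * (P + Q) ^ 3 := by
      rw [hN]
      -- With `x = a + b`, `N = P + Q`: `4N³ - 27x²(N - x) = (3x - 2N)²(3x + N)`.
      nlinarith [mul_nonneg (sq_nonneg (3 * (a + b : ℤ) - 2 * (P + Q)))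
        (show (0 : ℤ) ≤ 3 * (a + b) + (P + Q) by positivity)]
    have h3 : 12 * ((a : ℤ) * b * c) ≤ 3 * ((a + b) ^ 2 * c) := by nlinarith
    have h4 : 4 * (P + Q : ℤ) ^ 3 ≤ 45 * (P * Q * (P + 1 + (Q + 1) - 4)) := by
      -- In `R = P - 2` the difference of the two sides has nonnegative coefficients.
      obtain ⟨R, hR⟩ : ∃ R : ℕ, (P : ℤ) = R + 2 := ⟨P - 2, by omega⟩
      rcases (show (Q : ℤ) = P ∨ (Q : ℤ) = P + 1 by omega) with hQ | hQ <;> rw [hQ, hR] <;>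
        nlinarith [pow_nonneg (Int.natCast_nonneg R) 3, pow_nonneg (Int.natCast_nonneg R) 2,
          Int.natCast_nonneg R]
    linarith
  have h2 : a * b * (a + b - 2) ≤ P * Q * (P + 1 + (Q + 1) - 4) :=
    Nat.mul_le_mul hab (by omega)
  simp only [Nat.add_sub_cancel]
  set M := P * Q * (P + 1 + (Q + 1) - 4)
  have h3 : m * (a - 1) + m * (b - 1) = m * (a + b - 2) := by
    rw [← mul_add]; congr 1; omega
  rw [h3]
  -- The bound is linear in `(m, k)` with `m + k = a * b`, so the extremes `k = 0` and `m = 0`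
  -- suffice.
  have h4 : a * b * (5 * (m * (a + b - 2)) + 2 * 6 * (k * c)) ≤ a * b * (5 * M) := by
    calc _ = m * (5 * (a * b * (a + b - 2))) + k * (12 * (a * b * c)) := by ring
      _ ≤ m * (5 * M) + k * (5 * M) := by gcongr
      _ = _ := by rw [← add_mul, hm]
  exact Nat.le_of_mul_le_mul_left h4 (by positivity)

theorem edge_bound_of_small {n a b c m k : ℕ} (hn : n ≤ 5) (hs : a + b + c + 2 = n)
    (hm : m + k = a * b) :
    1 * (m * (a - 1) + m * (b - 1)) + 2 * 1 * (k * c) ≤ 2 * (n - 4) := by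
  have ha : a ≤ 3 := by omega
  have hb : b ≤ 3 := by omega
  have hc : c ≤ 3 := by omega
  interval_cases a <;> interval_cases b <;> interval_cases c <;> omega

end Bounds

theorem CliqueFree.pairCopyCount_le {n : ℕ} {G : SimpleGraph (Fin n)} (h : G.CliqueFree 3) :
    pairCopyCount (completeBipartiteGraph (Fin 2) (Fin 3)) (cycleGraph 5) G ≤
      (turanGraph n 2).copyCount (completeBipartiteGraph (Fin 2) (Fin 3)) := by
  classical
  have hT := le_labelledCopyCount_turanGraph_two n
  have hw := h.weighted_labelledCopyCount_le
  simp only [labelledCopyCount_eq_copyCount_mul, card_iso_completeBipartiteGraph_two_three,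
    card_iso_cycleGraph_five, Fintype.card_fin] at hT hw
  unfold pairCopyCount
  -- The weights 5, 6 fail at `n = 5`, `a = b = c = k = 1`, as `12 > 10`. Weights 1, 1 give `12x +
  -- 10y ≤ 12` there, and integrality yields `x + y ≤ 1`.
  rcases le_or_gt n 5 with hn | hn
  · have h1 := hw 1 1 (2 * (n - 4)) fun a b c m k h1 h2 => edge_bound_of_small hn h1 h2
    have : n ≤ 4 ∨ n = 5 := by omega
    rcases this with h4 | rfl
    · simp only [Nat.sub_eq_zero_of_le h4] at h1
      omega
    · norm_num [Nat.descFactorial] at h1 hT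
      omega
  · obtain ⟨p, q, hp, hq, hn', hpq, hqp⟩ : ∃ p q, n / 2 = p ∧ n - n / 2 = q ∧ n = p + q ∧ p ≤ q ∧
      q ≤ p + 1 := ⟨_, _, rfl, rfl, by omega, by omega, by omega⟩
    -- Since `5 * 12 = 6 * 10`, these weights count both kinds of copy equally.
    have h1 := hw 5 6 (5 * ((p - 1) * (q - 1) * (p + q - 4))) fun a b c m k h1 h2 =>
      edge_bound_of_large (by omega) hpq hqp (by omega) h2
    rw [hq, hp] at h1 hT
    have h3 : q.descFactorial 2 * p.descFactorial 3 + p.descFactorial 2 * q.descFactorial 3 =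
        p * q * ((p - 1) * (q - 1) * (p + q - 4)) := by
      have : p + q - 4 = (p - 2) + (q - 2) := by omega
      rw [this]
      simp only [Nat.descFactorial, Nat.sub_zero]
      ring
    rw [h3] at hT
    set M := (p - 1) * (q - 1) * (p + q - 4)
    have h5 : 2 * (p * q) * (5 * M) = 10 * (p * q * M) := by ring
    omega

end SimpleGraph

theorem mainTheorem8 (n : ℕ) :
    SimpleGraph.pairExtremalNumber n
        (completeBipartiteGraph (Fin 2) (Fin 3)) (SimpleGraph.cycleGraph 5)
        (SimpleGraph.completeGraph (Fin 3)) =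
      SimpleGraph.pairCopyCount
        (completeBipartiteGraph (Fin 2) (Fin 3)) (SimpleGraph.cycleGraph 5)
        (SimpleGraph.turanGraph n 2) := by
  classical
  apply le_antisymm
  · refine Finset.sup_le fun G hG => ?_
    have hG' : G.CliqueFree 3 := by
      have h := SimpleGraph.cliqueFree_iff_top_free (G := G) (β := Fin 3)
      rw [Fintype.card_fin] at h
      exact h.2 (Finset.mem_filter.1 hG).2
    exact hG'.pairCopyCount_le.trans (Nat.le_add_right _ _)
  · unfold SimpleGraph.pairExtremalNumber
    refine Finset.le_sup (f := fun G => SimpleGraph.pairCopyCount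
      (completeBipartiteGraph (Fin 2) (Fin 3)) (SimpleGraph.cycleGraph 5) G) ?_
    have hT := SimpleGraph.turanGraph_cliqueFree (n := n) (r := 2) (by norm_num)
    have h := SimpleGraph.cliqueFree_iff_top_free (G := SimpleGraph.turanGraph n 2) (β := Fin 3)
    rw [Fintype.card_fin] at h
    exact Finset.mem_filter.2 ⟨Finset.mem_univ _, h.1 hT⟩
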